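/- Let $\kappa$ be a cardinal with $\omega_1\le\kappa\le\mathfrak c$, let $\lambda$ be the usual product probability measure on the Baire $\sigma$-algebra of $2^\kappa$, let $\mathfrak B$ be its measure algebra (Baire sets modulo $\lambda$-null sets), and let $\mathfrak B^+=\mathfrak B\setminus\{\mathbf 0\}$. Let $\{N_b:b\in\mathfrak B^+\}$ be an independent family of subsets of $\mathbb N$, i.e. $\bigcap_{b\in s}N_b\setminus\bigcup_{b'\in t}N_{b'}\neq\emptyset$ for all disjoint finite $s,t\subseteq\mathfrak B^+$. For $b\in\mathfrak B^+$ define $G_b\in\mathfrak B^{\mathbb N}$ by $G_b(n)=b$ if $n\in N_b$ and $G_b(n)=\mathbf 0$ otherwise. Let $\mathfrak A$ be the subalgebra of the Boolean algebra $\mathfrak B^{\mathbb N}$ generated by $\{G_b:b\in\mathfrak B^+\}$, let $K$ be its Stone space (the compact space of all ultrafilters on $\mathfrak A$), and for $a\in\mathfrak A$ let $\widehat a=\{\mathcal F\in K:a\in\mathcal F\}$. For finite $r\subseteq\mathfrak B^+$ put $J(r)=\bigcap_{b\in r}G_b$ (so $J(\emptyset)=\mathbf 1$). Let $S'(K)$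 be the set of all $g\in C(K)$ that can be written as $$g=\sum_{r\subseteq s}y_r\,1_{\widehat{J(r)}}$$ for some finite set $s\subseteq\mathfrak B^+$ and some nonzero real numbers $y_r$ $(r\subseteq s)$. Then $S'(K)$ is norm dense in the space $C(K)$ of real-valued continuous functions on $K$, and the restriction of the supremum norm to $S'(K)$ is measurable with respect to the trace on $S'(K)$ of the Baire $\sigma$-algebra $\mathrm{Ba}(C(K),w)$ of the weak topology of $C(K)$. -/

import Mathlib

open MeasureTheory

noncomputable section

namespace WeakBaire

/-! The measure algebra of a measure: measurable sets modulo null sets. -/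

section MeasureAlgebra

variable {α : Type*} [MeasurableSpace α]

/-- Two measurable sets are identified when their symmetric difference is null. -/
def aeSetoid (μ : Measure α) : Setoid {s : Set α // MeasurableSet s} where
  r s t := s.1 =ᵐ[μ] t.1
  iseqv := ⟨fun _ => Filter.EventuallyEq.rfl, fun h => h.symm, fun h k => h.trans k⟩

/-- The measure algebra of `μ`. -/
def MeasureAlgebra (μ : Measure α) : Type _ := Quotient (aeSetoid μ)

namespace MeasureAlgebra

variable {μ : Measure α}

/-- The class of a measurable set. -/
def mk (μ : Measure α) (s : {s : Set α // MeasurableSet s}) : MeasureAlgebra μ :=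
  Quotient.mk (aeSetoid μ) s

theorem ind {p : MeasureAlgebra μ → Prop} (h : ∀ s, p (mk μ s)) (a : MeasureAlgebra μ) : p a :=
  Quotient.inductionOn a h

theorem mk_eq_mk {s t : {s : Set α // MeasurableSet s}} :
    mk μ s = mk μ t ↔ s.1 =ᵐ[μ] t.1 :=
  ⟨fun h => Quotient.exact h, fun h => Quotient.sound (s := aeSetoid μ) h⟩

instance : LE (MeasureAlgebra μ) where
  le := Quotient.lift₂ (fun s t => s.1 ≤ᵐ[μ] t.1) (fun _ _ _ _ h k => propext
    ⟨fun l => (h.symm.le.trans l).trans k.le, fun l => (h.le.trans l).trans k.symm.le⟩)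

theorem mk_le_mk {s t : {s : Set α // MeasurableSet s}} :
    mk μ s ≤ mk μ t ↔ s.1 ≤ᵐ[μ] t.1 := Iff.rfl

instance : Max (MeasureAlgebra μ) where
  max := Quotient.map₂ (fun s t => ⟨s.1 ∪ t.1, s.2.union t.2⟩)
    (fun _ _ h _ _ k => Filter.EventuallyEq.union h k)

instance : Min (MeasureAlgebra μ) where
  min := Quotient.map₂ (fun s t => ⟨s.1 ∩ t.1, s.2.inter t.2⟩)
    (fun _ _ h _ _ k => Filter.EventuallyEq.inter h k)

instance : Compl (MeasureAlgebra μ) where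
  compl := Quotient.map (fun s => ⟨s.1ᶜ, s.2.compl⟩)
    (fun _ _ h => Filter.EventuallyEq.compl h)

instance : Top (MeasureAlgebra μ) := ⟨mk μ ⟨Set.univ, MeasurableSet.univ⟩⟩

instance : Bot (MeasureAlgebra μ) := ⟨mk μ ⟨∅, MeasurableSet.empty⟩⟩

theorem mk_sup_mk (s t : {s : Set α // MeasurableSet s}) :
    mk μ s ⊔ mk μ t = mk μ ⟨s.1 ∪ t.1, s.2.union t.2⟩ := rfl

theorem mk_inf_mk (s t : {s : Set α // MeasurableSet s}) :
    mk μ s ⊓ mk μ t = mk μ ⟨s.1 ∩ t.1, s.2.inter t.2⟩ := rfl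

theorem compl_mk (s : {s : Set α // MeasurableSet s}) :
    (mk μ s)ᶜ = mk μ ⟨s.1ᶜ, s.2.compl⟩ := rfl

theorem top_eq : (⊤ : MeasureAlgebra μ) = mk μ ⟨Set.univ, MeasurableSet.univ⟩ := rfl

theorem bot_eq : (⊥ : MeasureAlgebra μ) = mk μ ⟨∅, MeasurableSet.empty⟩ := rfl

instance : BooleanAlgebra (MeasureAlgebra μ) where
  le_refl a := by
    induction a using ind with | h s => exact mk_le_mk.2 Filter.EventuallyLE.rfl
  le_trans a b c := by
    induction a using ind with | h s =>
    induction b using ind with | h t =>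
    induction c using ind with | h u =>
    exact fun h k => mk_le_mk.2 ((mk_le_mk.1 h).trans (mk_le_mk.1 k))
  le_antisymm a b := by
    induction a using ind with | h s =>
    induction b using ind with | h t =>
    exact fun h k => mk_eq_mk.2 ((mk_le_mk.1 h).antisymm (mk_le_mk.1 k))
  sup a b := a ⊔ b
  le_sup_left a b := by
    induction a using ind with | h s =>
    induction b using ind with | h t =>
    exact mk_le_mk.2 (Filter.Eventually.of_forall fun _ hx => Or.inl hx)
  le_sup_right a b := by
    induction a using ind with | h s =>
    induction b using ind with | h t =>
    exact mk_le_mk.2 (Filter.Eventually.of_forall fun _ hx => Or.inr hx)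
  sup_le a b c := by
    induction a using ind with | h s =>
    induction b using ind with | h t =>
    induction c using ind with | h u =>
    intro h k
    refine mk_le_mk.2 ?_
    filter_upwards [mk_le_mk.1 h, mk_le_mk.1 k] with x h1 h2
    exact fun hx => hx.elim h1 h2
  inf a b := a ⊓ b
  inf_le_left a b := by
    induction a using ind with | h s =>
    induction b using ind with | h t =>
    exact mk_le_mk.2 (Filter.Eventually.of_forall fun _ hx => hx.1)
  inf_le_right a b := by
    induction a using ind with | h s =>
    induction b using ind with | h t =>
    exact mk_le_mk.2 (Filter.Eventually.of_forall fun _ hx => hx.2)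
  le_inf a b c := by
    induction a using ind with | h s =>
    induction b using ind with | h t =>
    induction c using ind with | h u =>
    intro h k
    refine mk_le_mk.2 ?_
    filter_upwards [mk_le_mk.1 h, mk_le_mk.1 k] with x h1 h2
    exact fun hx => ⟨h1 hx, h2 hx⟩
  le_sup_inf a b c := by
    induction a using ind with | h s =>
    induction b using ind with | h t =>
    induction c using ind with | h u =>
    exact mk_le_mk.2 (Filter.Eventually.of_forall fun _ hx =>
      hx.1.elim Or.inl fun h1 => hx.2.elim Or.inl fun h2 => Or.inr ⟨h1, h2⟩)
  le_top a := by
    induction a using ind with | h s =>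
    exact mk_le_mk.2 (Filter.Eventually.of_forall fun _ _ => trivial)
  bot_le a := by
    induction a using ind with | h s =>
    exact mk_le_mk.2 (Filter.Eventually.of_forall fun _ hx => hx.elim)
  inf_compl_le_bot a := by
    induction a using ind with | h s =>
    exact mk_le_mk.2 (Filter.Eventually.of_forall fun _ hx => hx.2 hx.1)
  top_le_sup_compl a := by
    induction a using ind with | h s =>
    exact mk_le_mk.2 (Filter.Eventually.of_forall fun x _ => Classical.em (x ∈ s.1))

end MeasureAlgebra

end MeasureAlgebra

/-! The Stone space of a Boolean algebra. -/

section StoneSpace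

variable {A : Type*} [BooleanAlgebra A]

/-- `F` is an ultrafilter on the Boolean algebra `A`. -/
structure IsUltra (F : Set A) : Prop where
  top_mem : ⊤ ∈ F
  bot_notMem : ⊥ ∉ F
  mem_of_le : ∀ a b, a ∈ F → a ≤ b → b ∈ F
  inf_mem : ∀ a b, a ∈ F → b ∈ F → a ⊓ b ∈ F
  mem_or_compl_mem : ∀ a, a ∈ F ∨ aᶜ ∈ F

variable (A) in
/-- The Stone space of `A`: the set of all ultrafilters on `A`. -/
structure StoneSpace where
  /-- The underlying set of elements of `A`. -/
  carrier : Set A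
  isUltra : IsUltra carrier

/-- The set of all ultrafilters containing `a`. -/
def hat (a : A) : Set (StoneSpace A) := {F | a ∈ F.carrier}

/-- The topology of the Stone space, generated by the sets `hat a`. -/
instance : TopologicalSpace (StoneSpace A) :=
  TopologicalSpace.generateFrom (Set.range (hat : A → Set (StoneSpace A)))

instance : CompactSpace (StoneSpace A) := by
  refine ⟨isCompact_iff_ultrafilter_le_nhds.2 fun U _ => ?_⟩
  have hU : IsUltra {a : A | hat a ∈ U} := by
    refine ⟨?_, ?_, ?_, ?_, ?_⟩
    · exact Filter.mem_of_superset Filter.univ_mem fun F _ => F.isUltra.top_mem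
    · intro h
      obtain ⟨F, hF⟩ := U.nonempty_of_mem h
      exact F.isUltra.bot_notMem hF
    · intro a b ha hab
      exact Filter.mem_of_superset ha fun F hF => F.isUltra.mem_of_le a b hF hab
    · intro a b ha hb
      exact Filter.mem_of_superset (Filter.inter_mem ha hb) fun F hF =>
        F.isUltra.inf_mem a b hF.1 hF.2
    · intro a
      refine Ultrafilter.union_mem_iff.1 (Filter.mem_of_superset Filter.univ_mem fun F _ => ?_)
      exact F.isUltra.mem_or_compl_mem a
  refine ⟨⟨_, hU⟩, Set.mem_univ _, ?_⟩
  rw [TopologicalSpace.nhds_generateFrom]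
  refine le_iInf₂ fun s hs => ?_
  obtain ⟨h1, a, rfl⟩ := hs
  exact Filter.le_principal_iff.2 h1

end StoneSpace

/-! The weak Baire σ-algebra of a Banach space. -/

/-- The Baire σ-algebra of a topological space: the smallest σ-algebra that makes every continuous
real-valued function measurable. -/
abbrev baire (X : Type*) [TopologicalSpace X] : MeasurableSpace X :=
  ⨆ f : C(X, ℝ), (borel ℝ).comap f

/-- The Baire σ-algebra of the weak topology of `X`. -/
abbrev weakBaire (X : Type*) [NormedAddCommGroup X] [NormedSpace ℝ X] : MeasurableSpace X :=
  (baire (WeakSpace ℝ X)).comap (toWeakSpace ℝ X)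

/-! The construction of the compact space. -/

section Construction

/-- The usual product probability measure on the product σ-algebra (which is the Baire σ-algebra)
of the Cantor cube over the index set `I`. -/
def cubeMeasure (I : Type*) : Measure (I → Bool) :=
  Measure.infinitePi fun _ => (PMF.uniformOfFintype Bool).toMeasure

/-- The nonzero elements of a Boolean algebra. -/
abbrev Pos (B : Type*) [BooleanAlgebra B] : Type _ := {b : B // b ≠ ⊥}

/-- An indexed family of sets of natural numbers is independent. -/
def IsIndependent {ι : Type*} (N : ι → Set ℕ) : Prop :=
  ∀ s t : Finset ι, Disjoint s t → ((⋂ b ∈ s, N b) \ ⋃ b ∈ t, N b).Nonempty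

variable {B : Type*} [BooleanAlgebra B] (N : Pos B → Set ℕ)

open Classical in
/-- The sequence with value `b` on `N b` and `⊥` elsewhere. -/
def gen (b : Pos B) : ℕ → B := fun n => if n ∈ N b then b.1 else ⊥

/-- The subalgebra of `ℕ → B` generated by all `gen N b`. -/
def genAlg : BooleanSubalgebra (ℕ → B) := BooleanSubalgebra.closure (Set.range (gen N))

/-- The generator `gen N b` as an element of `genAlg N`. -/
def G (b : Pos B) : genAlg N :=
  ⟨gen N b, BooleanSubalgebra.subset_closure ⟨b, rfl⟩⟩

/-- The intersection of the generators indexed by `s`; it is `⊤` for empty `s`. -/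
def J (s : Finset (Pos B)) : genAlg N := s.inf (G N)

/-- The set of all continuous functions on the Stone space of `genAlg N` that can be written as
`∑ r ⊆ s, y r • 1_{hat (J r)}` for a finite set `s` and nonzero real coefficients `y r`. -/
def SPrime : Set C(StoneSpace (genAlg N), ℝ) :=
  {g | ∃ (s : Finset (Pos B)) (y : Finset (Pos B) → ℝ), (∀ r ∈ s.powerset, y r ≠ 0) ∧
    ∀ F, g F = ∑ r ∈ s.powerset, y r * (hat (J N r)).indicator 1 F}

end Construction

end WeakBaire

end

noncomputable section

namespace WeakBaire

/-! ### Ultrafilters on a Boolean algebra -/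

section Ultrafilters

variable {A : Type*} [BooleanAlgebra A]

/-! Let `g = ∑_{r ⊆ s} y_r 1_{J(r)}`. A point of K traces on `s` the set `t` of those `b` whose
generator it contains. Independence of `N` makes these traces exactly the `t ⊆ s` with nonzero meet
(`exists_point`, `inf_ne_bot_of_J_mem`), so `‖g‖` is the maximum of `|∑_{r ⊆ t} y_r|` over such `t`.
The task is to read this off from countably many weakly Baire functions that do not depend on `s`.

For large `n` the types `N_b ∩ {0, …, n-1}` separate the elements of `s`, so finite sets `U` of
types can stand for subsets of `s`. For `m ≥ 1`, averaging evaluations at random points of K gives a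
bounded functional sending `1_{J(r)}` to `λ(⋂ r)^m`, even restricted to those `r` drawn from a
prescribed `T` (`exists_functional_pow`). Linear combinations realise `1 - (1 - λ(⋂ r))^j` on the
`r` with type set `U`; as `j → ∞` this tends to 1 or 0 according to whether the meet of `r` is
nonzero. Hence the sum of `y_r` over the `r` with type set `U` and nonzero meet is a limit of
functionals (`exists_measurable_coeff`). Since no `y_r` vanishes, the support of these sums reveals
which `t` have nonzero meet, and the norm is a measurable function of the sums
(`norm_sum_smul_ind`).

Density is Stone–Weierstrass for the span of the indicators, followed by a small perturbation of the
zero coefficients. -/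

theorem IsUltra.inf_mem_iff {F : Set A} (hF : IsUltra F) {a b : A} :
    a ⊓ b ∈ F ↔ a ∈ F ∧ b ∈ F :=
  ⟨fun h => ⟨hF.mem_of_le _ _ h inf_le_left, hF.mem_of_le _ _ h inf_le_right⟩,
    fun h => hF.inf_mem _ _ h.1 h.2⟩

theorem IsUltra.compl_mem_iff {F : Set A} (hF : IsUltra F) {a : A} : aᶜ ∈ F ↔ a ∉ F :=
  ⟨fun h k => hF.bot_notMem (inf_compl_eq_bot (a := a) ▸ hF.inf_mem _ _ k h),
    fun h => (hF.mem_or_compl_mem a).resolve_left h⟩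

theorem IsUltra.sup_mem_iff {F : Set A} (hF : IsUltra F) {a b : A} :
    a ⊔ b ∈ F ↔ a ∈ F ∨ b ∈ F := by
  rw [← not_iff_not, ← hF.compl_mem_iff, compl_sup, hF.inf_mem_iff, hF.compl_mem_iff,
    hF.compl_mem_iff, not_or]

theorem IsUltra.finset_inf_mem_iff {ι : Type*} {F : Set A} (hF : IsUltra F) (r : Finset ι)
    (f : ι → A) : r.inf f ∈ F ↔ ∀ i ∈ r, f i ∈ F := by
  classical
  induction r using Finset.induction_on with
  | empty => simpa using hF.top_mem
  | insert i r _ ih => rw [Finset.inf_insert, hF.inf_mem_iff, ih, Finset.forall_mem_insert]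

theorem isClopen_hat (a : A) : IsClopen (hat a) := by
  have ho : ∀ a : A, IsOpen (hat a) := fun a => TopologicalSpace.isOpen_generateFrom_of_mem ⟨a, rfl⟩
  refine ⟨?_, ho a⟩
  rw [← isOpen_compl_iff]
  convert ho aᶜ using 1
  ext F
  exact F.isUltra.compl_mem_iff.symm

end Ultrafilters

/-! ### Points of K, the indicators `1_{J(r)}`, and density -/

section Construction

variable {B : Type*} [BooleanAlgebra B] (N : Pos B → Set ℕ)

theorem J_mem_iff (F : StoneSpace (genAlg N)) (r : Finset (Pos B)) :
    J N r ∈ F.carrier ↔ ∀ b ∈ r, G N b ∈ F.carrier :=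
  F.isUltra.finset_inf_mem_iff r (G N)

/-- Every coordinate of `J N r` lies below the meet of `r`, so a zero meet would force `J N r = ⊥`.
-/
theorem inf_ne_bot_of_J_mem (F : StoneSpace (genAlg N)) {r : Finset (Pos B)}
    (h : J N r ∈ F.carrier) : r.inf Subtype.val ≠ ⊥ := by
  intro h0
  apply F.isUltra.bot_notMem
  convert h
  symm
  apply Subtype.ext
  funext n
  refine le_bot_iff.1 (h0 ▸ Finset.le_inf fun b hb => ?_)
  have h1 : J N r ≤ G N b := Finset.inf_le hb
  have h2 : (J N r : ℕ → B) n ≤ gen N b n := h1 n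
  refine h2.trans ?_
  unfold gen
  split_ifs
  exacts [le_rfl, bot_le]

/-- An ultrafilter on the Boolean algebra of the values, placed at a coordinate, induces a point of
the Stone space. -/
def pointAt (n : ℕ) {U : Set B} (hU : IsUltra U) : StoneSpace (genAlg N) where
  carrier := {a | a.1 n ∈ U}
  isUltra :=
    { top_mem := hU.top_mem
      bot_notMem := hU.bot_notMem
      mem_of_le := fun _ _ ha hab => hU.mem_of_le _ _ ha (hab n)
      inf_mem := fun _ _ ha hb => hU.inf_mem _ _ ha hb
      mem_or_compl_mem := fun a => hU.mem_or_compl_mem (a.1 n) }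

theorem G_mem_pointAt (n : ℕ) {U : Set B} (hU : IsUltra U) (b : Pos B) :
    G N b ∈ (pointAt N n hU).carrier ↔ n ∈ N b ∧ b.1 ∈ U := by
  change gen N b n ∈ U ↔ _
  unfold gen
  split_ifs with h
  · simp [h]
  · simp [h, hU.bot_notMem]

/-- Membership in an ultrafilter commutes with joins and complements, so it is determined on
generators. -/
theorem stoneSpace_ext {F F' : StoneSpace (genAlg N)}
    (h : ∀ b, G N b ∈ F.carrier ↔ G N b ∈ F'.carrier) : F = F' := by
  have key : ∀ a : ℕ → B, ∀ ha : a ∈ genAlg N,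
      ((⟨a, ha⟩ : genAlg N) ∈ F.carrier ↔ (⟨a, ha⟩ : genAlg N) ∈ F'.carrier) := by
    intro a ha
    refine BooleanSubalgebra.closure_bot_sup_induction
      (p := fun a ha => ((⟨a, ha⟩ : genAlg N) ∈ F.carrier ↔ (⟨a, ha⟩ : genAlg N) ∈ F'.carrier))
      ?_ ?_ ?_ ?_ ha
    · rintro _ ⟨b, rfl⟩
      exact h b
    · exact iff_of_false F.isUltra.bot_notMem F'.isUltra.bot_notMem
    · intro x hx y hy h1 h2
      exact F.isUltra.sup_mem_iff.trans ((or_congr h1 h2).trans F'.isUltra.sup_mem_iff.symm)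
    · intro x hx h1
      exact F.isUltra.compl_mem_iff.trans ((not_congr h1).trans F'.isUltra.compl_mem_iff.symm)
  cases F
  cases F'
  congr 1
  ext a
  exact key a.1 a.2

/-- The indicator function of the clopen set given by `J N r`. -/
def ind (r : Finset (Pos B)) : C(StoneSpace (genAlg N), ℝ) where
  toFun := (hat (J N r)).indicator 1
  continuous_toFun := (continuous_const (y := (1 : ℝ))).indicator (s := hat (J N r))
    (fun a ha => by simp [(isClopen_hat (J N r)).frontier_eq] at ha)

open Classical in
theorem ind_apply (r : Finset (Pos B)) (F : StoneSpace (genAlg N)) :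
    ind N r F = if ∀ b ∈ r, G N b ∈ F.carrier then 1 else 0 := by
  simp only [← J_mem_iff]
  rfl

open Classical in
theorem ind_mul_ind (r r' : Finset (Pos B)) : ind N r * ind N r' = ind N (r ∪ r') := by
  ext F
  simp only [ContinuousMap.mul_apply, ind_apply, Finset.forall_mem_union, ite_and]
  split_ifs <;> simp

theorem ind_empty : ind N ∅ = 1 := by
  classical
  ext F
  simp [ind_apply]

theorem mem_SPrime_iff {g : C(StoneSpace (genAlg N), ℝ)} :
    g ∈ SPrime N ↔ ∃ (s : Finset (Pos B)) (y : Finset (Pos B) → ℝ),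
      (∀ r ∈ s.powerset, y r ≠ 0) ∧ g = ∑ r ∈ s.powerset, y r • ind N r := by
  refine exists_congr fun s => exists_congr fun y => and_congr_right fun _ => ?_
  rw [ContinuousMap.ext_iff]
  simp only [ContinuousMap.sum_apply, ContinuousMap.smul_apply, smul_eq_mul]
  rfl

/-- The indicators are closed under products and contain 1, so their span is already a subalgebra;
it separates points because the generators do. -/
theorem dense_span_ind :
    Dense (Submodule.span ℝ (Set.range (ind N)) : Set C(StoneSpace (genAlg N), ℝ)) := by
  classical
  have hsub : (Submonoid.closure (Set.range (ind N)) : Set C(StoneSpace (genAlg N), ℝ)) ⊆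
      Submodule.span ℝ (Set.range (ind N)) := by
    intro f hf
    refine Submodule.subset_span ?_
    induction hf using Submonoid.closure_induction with
    | mem f hf => exact hf
    | one => exact ⟨∅, ind_empty N⟩
    | mul f g _ _ hf hg =>
      obtain ⟨r, rfl⟩ := hf
      obtain ⟨r', rfl⟩ := hg
      exact ⟨_, (ind_mul_ind N r r').symm⟩
  have hspan := Algebra.adjoin_eq_span_of_subset (R := ℝ) hsub
  have htop := ContinuousMap.subalgebra_topologicalClosure_eq_top_of_separatesPoints
    (Algebra.adjoin ℝ (Set.range (ind N))) (by
      intro F F' hne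
      by_contra hcon
      refine hne (stoneSpace_ext N fun b => ?_)
      by_contra hb
      refine hcon ⟨ind N {b}, ⟨ind N {b}, Algebra.subset_adjoin ⟨_, rfl⟩, rfl⟩, ?_⟩
      simp only [ind_apply, Finset.mem_singleton, forall_eq]
      split_ifs <;> simp_all)
  rw [← hspan]
  intro f
  have : f ∈ (Algebra.adjoin ℝ (Set.range (ind N))).topologicalClosure := htop ▸ Algebra.mem_top
  exact this

theorem exists_powerset_sum_of_mem_span {g : C(StoneSpace (genAlg N), ℝ)}
    (hg : g ∈ Submodule.span ℝ (Set.range (ind N))) :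
    ∃ (s : Finset (Pos B)) (z : Finset (Pos B) → ℝ), g = ∑ r ∈ s.powerset, z r • ind N r := by
  classical
  obtain ⟨c, rfl⟩ := Finsupp.mem_span_range_iff_exists_finsupp.1 hg
  -- The union of all index sets involved; the additional subsets carry coefficient 0.
  refine ⟨c.support.sup id, c, ?_⟩
  refine Finset.sum_subset (fun r hr => ?_) fun r _ hr => ?_
  · exact Finset.mem_powerset.2 (Finset.le_sup (f := id) hr)
  · simp [Finsupp.notMem_support_iff.1 hr]

theorem dense_SPrime : Dense (SPrime N) := by
  classical
  refine fun f => (dense_span_ind N f : f ∈ closure _) |> fun hf => ?_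
  refine closure_minimal (fun g hg => ?_) isClosed_closure hf
  obtain ⟨s, z, rfl⟩ := exists_powerset_sum_of_mem_span N hg
  -- Vanishing coefficients are replaced by `δ`, which tends to 0 through nonzero values.
  let y : ℝ → Finset (Pos B) → ℝ := fun δ r => if z r = 0 then δ else z r
  have hlim : Filter.Tendsto (fun δ => ∑ r ∈ s.powerset, y δ r • ind N r) (nhdsWithin 0 {0}ᶜ)
      (nhds (∑ r ∈ s.powerset, z r • ind N r)) := by
    refine tendsto_finsetSum _ fun r _ => Filter.Tendsto.smul_const ?_ _
    by_cases h : z r = 0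
    · simpa [y, h, Function.id_def] using (Filter.tendsto_id.mono_left nhdsWithin_le_nhds :
        Filter.Tendsto id (nhdsWithin (0 : ℝ) {0}ᶜ) (nhds 0))
    · simp [y, h]
  refine mem_closure_of_tendsto hlim ?_
  filter_upwards [self_mem_nhdsWithin] with δ hδ
  refine (mem_SPrime_iff N).2 ⟨s, y δ, fun r _ => ?_, rfl⟩
  by_cases h : z r = 0
  · simpa [y, h] using hδ
  · simp [y, h]

end Construction

open Filter Topology

/-! ### Representatives and ultrafilters in the measure algebra -/

section MeasureAlgebra

variable {α : Type*} [MeasurableSpace α] {μ : Measure α}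

theorem mem_congr_of_eventuallyEq {X : Type*} {l : Filter X} {s t : Set X} (h : s =ᶠ[l] t) :
    s ∈ l ↔ t ∈ l :=
  eventually_congr h.mem_iff

namespace MeasureAlgebra

/-- A measurable set representing an element of the measure algebra. -/
def rep (a : MeasureAlgebra μ) : Set α := (Quotient.out a : {s : Set α // MeasurableSet s}).1

theorem measurableSet_rep (a : MeasureAlgebra μ) : MeasurableSet a.rep :=
  (Quotient.out a : {s : Set α // MeasurableSet s}).2

theorem mk_rep (a : MeasureAlgebra μ) : mk μ ⟨a.rep, a.measurableSet_rep⟩ = a :=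
  Quotient.out_eq a

theorem rep_mk (s : {s : Set α // MeasurableSet s}) : (mk μ s).rep =ᵐ[μ] s.1 :=
  mk_eq_mk.1 (mk_rep (mk μ s))

theorem rep_inf (a b : MeasureAlgebra μ) : (a ⊓ b).rep =ᵐ[μ] (a.rep ∩ b.rep : Set α) := by
  have h := mk_inf_mk (μ := μ) ⟨a.rep, a.measurableSet_rep⟩ ⟨b.rep, b.measurableSet_rep⟩
  rw [mk_rep, mk_rep] at h
  have h2 := rep_mk (μ := μ) ⟨a.rep ∩ b.rep, a.measurableSet_rep.inter b.measurableSet_rep⟩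
  rwa [← h] at h2

theorem rep_compl (a : MeasureAlgebra μ) : aᶜ.rep =ᵐ[μ] (a.repᶜ : Set α) := by
  have h := compl_mk (μ := μ) ⟨a.rep, a.measurableSet_rep⟩
  rw [mk_rep] at h
  have h2 := rep_mk (μ := μ) ⟨a.repᶜ, a.measurableSet_rep.compl⟩
  rwa [← h] at h2

theorem rep_top : (⊤ : MeasureAlgebra μ).rep =ᵐ[μ] (Set.univ : Set α) := rep_mk _

theorem rep_bot : (⊥ : MeasureAlgebra μ).rep =ᵐ[μ] (∅ : Set α) := rep_mk _

theorem rep_mono {a b : MeasureAlgebra μ} (h : a ≤ b) : a.rep ≤ᵐ[μ] b.rep := by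
  rw [← mk_rep a, ← mk_rep b] at h
  exact mk_le_mk.1 h

theorem eq_bot_iff_measure_rep {a : MeasureAlgebra μ} : a = ⊥ ↔ μ a.rep = 0 := by
  conv_lhs => rw [← mk_rep a, bot_eq, mk_eq_mk]
  exact ae_eq_empty

theorem rep_finset_inf {ι : Type*} (r : Finset ι) (f : ι → MeasureAlgebra μ) :
    (r.inf f).rep =ᵐ[μ] (⋂ i ∈ r, (f i).rep : Set α) := by
  classical
  induction r using Finset.induction_on with
  | empty => simpa using rep_top
  | insert i r _ ih =>
    rw [Finset.inf_insert, Finset.set_biInter_insert]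
    exact (rep_inf _ _).trans ((EventuallyEq.refl _ _).inter ih)

/-- An ultrafilter of sets finer than the almost everywhere filter induces an ultrafilter on the
measure algebra. -/
theorem isUltra_of_le_ae (U : Ultrafilter α) (hU : (U : Filter α) ≤ ae μ) :
    IsUltra {a : MeasureAlgebra μ | a.rep ∈ U} where
  top_mem := (mem_congr_of_eventuallyEq (hU rep_top)).2 univ_mem
  bot_notMem h := U.empty_notMem ((mem_congr_of_eventuallyEq (hU rep_bot)).1 h)
  mem_of_le a b ha hab := by
    have h1 : ∀ᶠ x in (U : Filter α), x ∈ a.rep → x ∈ b.rep := hU (rep_mono hab)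
    have h2 : ∀ᶠ x in (U : Filter α), x ∈ a.rep := ha
    exact h1.mp (h2.mono fun x hx h => h hx)
  inf_mem a b ha hb := (mem_congr_of_eventuallyEq (hU (rep_inf a b))).2 (inter_mem ha hb)
  mem_or_compl_mem a := by
    refine (Ultrafilter.mem_or_compl_mem U a.rep).imp id fun h => ?_
    exact (mem_congr_of_eventuallyEq (hU (rep_compl a))).2 h

/-- An ultrafilter of sets refining the almost everywhere filter of `μ` restricted to `a.rep` does
it; that filter is proper because `a.rep` is not null. -/
theorem exists_isUltra_mem {a : MeasureAlgebra μ} (ha : a ≠ ⊥) :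
    ∃ U : Set (MeasureAlgebra μ), IsUltra U ∧ a ∈ U := by
  have hne : NeBot (ae (μ.restrict a.rep)) := by
    rw [ae_neBot, Ne, Measure.restrict_eq_zero, ← eq_bot_iff_measure_rep]
    exact ha
  have hle := Ultrafilter.of_le (ae (μ.restrict a.rep))
  refine ⟨_, isUltra_of_le_ae (Ultrafilter.of (ae (μ.restrict a.rep)))
    (hle.trans (ae_mono Measure.restrict_le_self)), ?_⟩
  exact hle (ae_restrict_mem a.measurableSet_rep)

end MeasureAlgebra

/-! ### Functionals realising powers of the measure -/

open MeasureAlgebra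

/-- The measure of the intersection of finitely many elements of the measure algebra. -/
def wt (r : Finset (Pos (MeasureAlgebra μ))) : ℝ := μ.real (⋂ b ∈ r, b.1.rep)

theorem wt_nonneg (r : Finset (Pos (MeasureAlgebra μ))) : 0 ≤ wt r := measureReal_nonneg

theorem wt_le_one [IsProbabilityMeasure μ] (r : Finset (Pos (MeasureAlgebra μ))) : wt r ≤ 1 :=
  measureReal_le_one

theorem inf_eq_bot_iff (r : Finset (Pos (MeasureAlgebra μ))) :
    r.inf Subtype.val = ⊥ ↔ μ (⋂ b ∈ r, b.1.rep) = 0 := by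
  rw [eq_bot_iff_measure_rep, measure_congr (rep_finset_inf r Subtype.val)]

theorem wt_eq_zero_iff [IsProbabilityMeasure μ] (r : Finset (Pos (MeasureAlgebra μ))) :
    wt r = 0 ↔ r.inf Subtype.val = ⊥ := by
  rw [inf_eq_bot_iff, wt, measureReal_eq_zero_iff]

variable {N : Pos (MeasureAlgebra μ) → Set ℕ}

/-- Independence gives a coordinate `n` in `N b` for `b ∈ t` and outside it for `b ∈ s \ t`. There
the generators from `t` take their own values and the others from `s` vanish, so an ultrafilter
containing the meet of `t`, placed at `n`, has the required trace. -/
theorem exists_point (hN : IsIndependent N) {s t : Finset (Pos (MeasureAlgebra μ))}     (ht : t.inf Subtype.val ≠ ⊥) :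
    ∃ F : StoneSpace (genAlg N), ∀ b ∈ s, (G N b ∈ F.carrier ↔ b ∈ t) := by
  classical
  obtain ⟨n, hn1, hn2⟩ := hN t (s \ t) Finset.disjoint_sdiff
  obtain ⟨U, hU, htU⟩ := exists_isUltra_mem ht
  rw [hU.finset_inf_mem_iff] at htU
  simp only [Set.mem_iInter, Set.mem_iUnion, Finset.mem_sdiff, not_exists] at hn1 hn2
  refine ⟨pointAt N n hU, fun b hb => ?_⟩
  rw [G_mem_pointAt]
  refine ⟨fun h => ?_, fun h => ⟨hn1 b h, htU b h⟩⟩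
  by_contra hbt
  exact hn2 b ⟨hb, hbt⟩ h.1

open Classical in
/-- The random finite set of those elements of `s ∩ T` that contain all sample points. -/
def sample (T : Set (Pos (MeasureAlgebra μ))) (s : Finset (Pos (MeasureAlgebra μ))) {m : ℕ}
    (ω : Fin m → α) : Finset (Pos (MeasureAlgebra μ)) :=
  s.filter fun b => b ∈ T ∧ ∀ i, ω i ∈ b.1.rep

theorem measurableSet_sample_eq (T : Set (Pos (MeasureAlgebra μ)))
    (s t : Finset (Pos (MeasureAlgebra μ))) (m : ℕ) :
    MeasurableSet {ω : Fin m → α | sample T s ω = t} := by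
  have : {ω : Fin m → α | sample T s ω = t} =
      {ω | (∀ b ∈ t, b ∈ s) ∧ ∀ b ∈ s, (b ∈ t ↔ b ∈ T ∧ ∀ i, ω i ∈ b.1.rep)} := by
    ext ω
    simp only [Set.mem_ofPred_eq, Finset.ext_iff, sample, Finset.mem_filter]
    constructor
    · exact fun h => ⟨fun b hb => ((h b).2 hb).1, fun b hb => by rw [← h b]; simp [hb]⟩
    · rintro ⟨h1, h2⟩ b
      by_cases hb : b ∈ s
      · rw [h2 b hb]; simp [hb]
      · simp only [hb, false_and, false_iff]; exact fun h => hb (h1 b h)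
  rw [this]
  refine (MeasurableSet.const _).inter ?_
  have h : ∀ b ∈ s, MeasurableSet {ω : Fin m → α | b ∈ t ↔ b ∈ T ∧ ∀ i, ω i ∈ b.1.rep} := by
    refine fun b _ => (MeasurableSet.const _).iff ((MeasurableSet.const _).inter ?_)
    have h2 := MeasurableSet.iInter fun i : Fin m =>
      measurable_pi_apply i (measurableSet_rep b.1)
    have h3 : {ω : Fin m → α | ∀ i, ω i ∈ b.1.rep} = ⋂ i, (fun ω => ω i) ⁻¹' b.1.rep := by
      ext ω
      simp
    rw [← h3] at h2
    exact h2
  have h4 : {ω : Fin m → α | ∀ b ∈ s, (b ∈ t ↔ b ∈ T ∧ ∀ i, ω i ∈ b.1.rep)} =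
      ⋂ b ∈ s, {ω | b ∈ t ↔ b ∈ T ∧ ∀ i, ω i ∈ b.1.rep} := by
    ext ω
    simp
  have h5 := s.measurableSet_biInter h
  rw [← h4] at h5
  exact h5

theorem measure_pi_forall_rep [IsProbabilityMeasure μ] (r : Finset (Pos (MeasureAlgebra μ)))
    (m : ℕ) :
    (Measure.pi fun _ : Fin m => μ).real {ω | ∀ b ∈ r, ∀ i, ω i ∈ b.1.rep} = wt r ^ m := by
  have : {ω : Fin m → α | ∀ b ∈ r, ∀ i, ω i ∈ b.1.rep} =
      Set.pi Set.univ fun _ => ⋂ b ∈ r, b.1.rep := by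
    ext ω
    simp only [Set.mem_ofPred_eq, Set.mem_pi, Set.mem_univ, forall_const, Set.mem_iInter]
    exact ⟨fun h i b hb => h b hb i, fun h b hb i => h i b hb⟩
  rw [this, measureReal_def, Measure.pi_pi]
  simp [wt, measureReal_def]

open Classical in
-- Draw `m` independent sample points and evaluate at a point of K whose trace on `s` is the random
-- set `sample T s ω`. The expected value of `1_{J(r)}` is the probability that `r ⊆ sample T s ω`,
-- which is `wt r ^ m` when `r ⊆ T` and 0 otherwise.
theorem exists_functional_finite [IsProbabilityMeasure μ] (hN : IsIndependent N)
    (T : Set (Pos (MeasureAlgebra μ))) {m : ℕ} (hm : m ≠ 0)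
    (s : Finset (Pos (MeasureAlgebra μ))) :
    ∃ φ : StrongDual ℝ C(StoneSpace (genAlg N), ℝ), ‖φ‖ ≤ 1 ∧
      ∀ r ⊆ s, φ (ind N r) = if ∀ b ∈ r, b ∈ T then wt r ^ m else 0 := by
  set P : Measure (Fin m → α) := Measure.pi fun _ => μ
  have hpt : ∀ t : Finset (Pos (MeasureAlgebra μ)), ∃ F : StoneSpace (genAlg N),
      t ⊆ s → t.inf Subtype.val ≠ ⊥ → ∀ b ∈ s, (G N b ∈ F.carrier ↔ b ∈ t) := by
    intro t
    by_cases h : t ⊆ s ∧ t.inf Subtype.val ≠ ⊥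
    · obtain ⟨F, hF⟩ := exists_point (s := s) hN h.2
      exact ⟨F, fun _ _ => hF⟩
    -- A dummy value: the empty family has meet `⊤`, nonzero because the total mass is 1.
    · obtain ⟨F, -⟩ := exists_point (s := s) (t := ∅) hN (by
        rw [Ne, ← wt_eq_zero_iff]
        simp [wt])
      exact ⟨F, fun h1 h2 => absurd ⟨h1, h2⟩ h⟩
  choose p hp using hpt
  have hunion : ∀ u ⊆ s.powerset, ∑ t ∈ u, P.real {ω | sample T s ω = t} =
      P.real {ω | sample T s ω ∈ u} := by
    intro u _
    rw [← measureReal_biUnion_finset]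
    · congr 1
      ext ω
      simp
    · intro t _ t' _ htt
      refine Set.disjoint_left.2 fun ω h1 h2 => htt ?_
      exact (show sample T s ω = t from h1).symm.trans h2
    · exact fun t _ => measurableSet_sample_eq T s t m
  refine ⟨∑ t ∈ s.powerset, P.real {ω | sample T s ω = t} • ContinuousMap.evalCLM ℝ (p t), ?_, ?_⟩
  · refine ContinuousLinearMap.opNorm_le_bound _ zero_le_one fun g => ?_
    simp only [sum_apply, smul_apply, smul_eq_mul]
    calc ‖∑ t ∈ s.powerset, P.real {ω | sample T s ω = t} * g (p t)‖
        ≤ ∑ t ∈ s.powerset, P.real {ω | sample T s ω = t} * ‖g‖ := by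
          refine norm_sum_le_of_le _ fun t _ => ?_
          rw [norm_mul, Real.norm_of_nonneg measureReal_nonneg]
          exact mul_le_mul_of_nonneg_left (g.norm_coe_le_norm _) measureReal_nonneg
      _ = P.real {ω | sample T s ω ∈ s.powerset} * ‖g‖ := by
          rw [← Finset.sum_mul, hunion _ subset_rfl]
      _ ≤ 1 * ‖g‖ := mul_le_mul_of_nonneg_right measureReal_le_one (norm_nonneg _)
  · intro r hr
    simp only [sum_apply, smul_apply, smul_eq_mul]
    calc ∑ t ∈ s.powerset, P.real {ω | sample T s ω = t} * ind N r (p t)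
        = ∑ t ∈ s.powerset, if r ⊆ t then P.real {ω | sample T s ω = t} else 0 := by
          refine Finset.sum_congr rfl fun t ht => ?_
          rw [Finset.mem_powerset] at ht
          -- If the meet of `t` is zero, drawing `t` puts all sample points in a null set. As `m ≠
          -- 0` this has probability 0, so the dummy points do not contribute.
          by_cases h0 : t.inf Subtype.val = ⊥
          · have : P.real {ω | sample T s ω = t} = 0 := by
              refine le_antisymm ?_ measureReal_nonneg
              have h1 := measure_pi_forall_rep t m
              rw [(wt_eq_zero_iff t).2 h0, zero_pow hm] at h1
              rw [← h1]
              refine measureReal_mono fun ω hω b hb i => ?_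
              rw [Set.mem_ofPred_eq] at hω
              rw [← hω] at hb
              exact (Finset.mem_filter.1 hb).2.2 i
            simp [this]
          · rw [ind_apply]
            have : (∀ b ∈ r, G N b ∈ (p t).carrier) ↔ r ⊆ t :=
              forall₂_congr fun b hb => hp t ht h0 b (hr hb)
            simp only [this, mul_ite, mul_one, mul_zero]
      _ = P.real {ω | sample T s ω ∈ s.powerset.filter (r ⊆ ·)} := by
          rw [← Finset.sum_filter, hunion _ (Finset.filter_subset _ _)]
      _ = P.real {ω | ∀ b ∈ r, b ∈ T ∧ ∀ i, ω i ∈ b.1.rep} := by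
          congr 1
          ext ω
          have : sample T s ω ⊆ s := Finset.filter_subset _ _
          simp only [Finset.mem_filter, Finset.mem_powerset, this, true_and, Set.mem_ofPred_eq]
          refine forall₂_congr fun b hb => ?_
          simp [sample, hr hb]
      _ = _ := by
          split_ifs with h
          · rw [← measure_pi_forall_rep]
            congr 1
            ext ω
            exact forall₂_congr fun b hb => and_iff_right (h b hb)
          · convert measureReal_empty
            rw [Set.eq_empty_iff_forall_notMem]
            exact fun ω hω => h fun b hb => (hω b hb).1

open Classical in
-- Weak* compactness of the unit ball gives a cluster point along growing `s`; for fixed `r` the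
-- values on `ind N r` are constant once `r ⊆ s`.
theorem exists_functional_pow [IsProbabilityMeasure μ] (hN : IsIndependent N)
    (T : Set (Pos (MeasureAlgebra μ))) {m : ℕ} (hm : m ≠ 0) :
    ∃ φ : StrongDual ℝ C(StoneSpace (genAlg N), ℝ),
      ∀ r, φ (ind N r) = if ∀ b ∈ r, b ∈ T then wt r ^ m else 0 := by
  choose φ hφ1 hφ2 using exists_functional_finite hN T hm
  have hcomp := WeakDual.isCompact_closedBall (𝕜 := ℝ) (E := C(StoneSpace (genAlg N), ℝ)) 0 1
  obtain ⟨ψ, -, hψ⟩ := hcomp.exists_mapClusterPt (f := atTop)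
    (u := fun s => StrongDual.toWeakDual (φ s)) (tendsto_principal.2 (Eventually.of_forall
      fun s => by simpa using hφ1 s))
  refine ⟨WeakDual.toStrongDual ψ, fun r => ?_⟩
  have h1 : MapClusterPt (ψ (ind N r)) atTop
      ((fun ξ : WeakDual ℝ C(StoneSpace (genAlg N), ℝ) => ξ (ind N r)) ∘
        fun s => StrongDual.toWeakDual (φ s)) :=
    hψ.continuousAt_comp (WeakDual.eval_continuous _).continuousAt
  have h2 : Tendsto ((fun ξ : WeakDual ℝ C(StoneSpace (genAlg N), ℝ) => ξ (ind N r)) ∘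
        fun s => StrongDual.toWeakDual (φ s)) atTop
      (𝓝 (if ∀ b ∈ r, b ∈ T then wt r ^ m else 0)) :=
    tendsto_const_nhds.congr' ((eventually_ge_atTop r).mono fun s hs => (hφ2 s r hs).symm)
  exact (mapClusterPt_iff_ultrafilter.1 h1).elim fun U hU =>
    tendsto_nhds_unique hU.2 (h2.mono_left hU.1)

end MeasureAlgebra

/-! ### From powers to coefficients grouped by types -/

section TraceNorm

variable {α : Type*} [MeasurableSpace α] {μ : Measure α} {N : Pos (MeasureAlgebra μ) → Set ℕ}

variable (N) in
/-- The coefficient system `c` is realised by a bounded functional on the finite intersections of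
the generators. -/
def IsRealized (c : Finset (Pos (MeasureAlgebra μ)) → ℝ) : Prop :=
  ∃ φ : StrongDual ℝ C(StoneSpace (genAlg N), ℝ), ∀ r, φ (ind N r) = c r

theorem IsRealized.sub {c d : Finset (Pos (MeasureAlgebra μ)) → ℝ} (hc : IsRealized N c)
    (hd : IsRealized N d) : IsRealized N (c - d) := by
  obtain ⟨φ, hφ⟩ := hc
  obtain ⟨ψ, hψ⟩ := hd
  exact ⟨φ - ψ, fun r => by simp [hφ, hψ]⟩

theorem IsRealized.sum {ι : Type*} {c : ι → Finset (Pos (MeasureAlgebra μ)) → ℝ} {u : Finset ι}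
    (hc : ∀ i ∈ u, IsRealized N (c i)) : IsRealized N (∑ i ∈ u, c i) := by
  choose! φ hφ using hc
  refine ⟨∑ i ∈ u, φ i, fun r => ?_⟩
  rw [sum_apply, Finset.sum_apply]
  exact Finset.sum_congr rfl fun i hi => hφ i hi r

variable (N) in
open Classical in
/-- The set of numbers below `n` that belong to `N b`. -/
def type (n : ℕ) (b : Pos (MeasureAlgebra μ)) : Finset ℕ := (Finset.range n).filter (· ∈ N b)

/-- By independence some `k` lies in `N b` but not in `N b'`, and every `n > k` sees it. -/
theorem eventually_type_injOn (hN : IsIndependent N) (s : Finset (Pos (MeasureAlgebra μ))) :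
    ∀ᶠ n in atTop, Set.InjOn (type N n) s := by
  classical
  have h : ∀ b ∈ s, ∀ b' ∈ s, ∀ᶠ n in atTop, type N n b = type N n b' → b = b' := by
    intro b _ b' _
    by_cases hb : b = b'
    · exact Eventually.of_forall fun _ _ => hb
    · obtain ⟨k, hk1, hk2⟩ := hN {b} {b'} (by simpa using hb)
      simp only [Finset.mem_singleton, Set.iInter_iInter_eq_left, Set.iUnion_iUnion_eq_left]
        at hk1 hk2
      filter_upwards [eventually_gt_atTop k] with n hn h
      have h1 : k ∈ type N n b := Finset.mem_filter.2 ⟨Finset.mem_range.2 hn, hk1⟩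
      rw [h] at h1
      exact absurd (Finset.mem_filter.1 h1).2 hk2
  have h2 : ∀ᶠ n in atTop, ∀ b ∈ s, ∀ b' ∈ s, type N n b = type N n b' → b = b' :=
    s.eventually_all.2 fun b hb => s.eventually_all.2 (h b hb)
  exact h2.mono fun n hn b hb b' hb' => hn b hb b' hb'

open Classical in
-- Taking `T` to be the set of `b` with type in `U` realises the condition "type set contained in
-- `U`"; subtracting the proper subsets of `U` leaves equality.
theorem isRealized_pow [IsProbabilityMeasure μ] (hN : IsIndependent N) (n : ℕ)
    (U : Finset (Finset ℕ)) {m : ℕ} (hm : m ≠ 0) :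
    IsRealized N fun r => if r.image (type N n) = U then wt r ^ m else 0 := by
  induction U using Finset.strongInduction with
  | H U ih =>
    have h1 : IsRealized N fun r => if r.image (type N n) ⊆ U then wt r ^ m else 0 := by
      obtain ⟨φ, hφ⟩ := exists_functional_pow hN {b | type N n b ∈ U} hm
      refine ⟨φ, fun r => ?_⟩
      simp only [hφ, Finset.image_subset_iff, Set.mem_ofPred_eq]
      congr
    have h2 := h1.sub (IsRealized.sum (u := U.ssubsets)
      (c := fun V r => if r.image (type N n) = V then wt r ^ m else 0)
      fun V hV => ih V (Finset.mem_ssubsets.1 hV))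
    convert h2 using 2 with r
    simp only [Pi.sub_apply, Finset.sum_apply, Finset.sum_ite_eq, Finset.mem_ssubsets,
      Finset.ssubset_iff_subset_ne]
    split_ifs <;> simp_all

open Classical in
theorem isRealized_pow_mul [IsProbabilityMeasure μ] (hN : IsIndependent N) (n : ℕ)
    (U : Finset (Finset ℕ)) (j : ℕ) {m : ℕ} (hm : m ≠ 0) :
    IsRealized N fun r =>
      if r.image (type N n) = U then wt r ^ m * (1 - wt r) ^ j else 0 := by
  induction j generalizing m with
  | zero => simpa using isRealized_pow hN n U hm
  | succ j ih =>
    -- `w^m (1-w)^(j+1) = w^m (1-w)^j - w^(m+1) (1-w)^j`.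
    convert (ih hm).sub (ih m.succ_ne_zero) using 2 with r
    rw [Pi.sub_apply]
    split_ifs
    · rw [Nat.succ_eq_add_one]
      ring
    · ring

open Classical in
-- A geometric sum: `1 - (1-w)^j = w ∑_{i<j} (1-w)^i` has no constant term in `w`, so only positive
-- powers are needed.
theorem isRealized_one_sub_pow [IsProbabilityMeasure μ] (hN : IsIndependent N) (n : ℕ)
    (U : Finset (Finset ℕ)) (j : ℕ) :
    IsRealized N fun r => if r.image (type N n) = U then 1 - (1 - wt r) ^ j else 0 := by
  have h := IsRealized.sum (u := Finset.range j) fun i _ =>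
    isRealized_pow_mul hN n U i one_ne_zero
  convert h using 2 with r
  rw [Finset.sum_apply]
  split_ifs
  · have := mul_neg_geom_sum (1 - wt r) j
    rw [← this, Finset.mul_sum]
    refine Finset.sum_congr rfl fun i _ => ?_
    ring
  · simp

open Classical in
theorem tendsto_one_sub_pow [IsProbabilityMeasure μ] (r : Finset (Pos (MeasureAlgebra μ))) :
    Tendsto (fun j : ℕ => 1 - (1 - wt r) ^ j) atTop
      (𝓝 (if r.inf Subtype.val = ⊥ then 0 else 1)) := by
  rw [← wt_eq_zero_iff]
  split_ifs with h
  · simp [h]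
  · have h0 : 0 < wt r := (wt_nonneg r).lt_of_ne' h
    simpa using (tendsto_pow_atTop_nhds_zero_of_lt_one (sub_nonneg.2 (wt_le_one r))
      (sub_lt_self 1 h0)).const_sub 1

theorem measurable_functional {X : Type*} [NormedAddCommGroup X] [NormedSpace ℝ X]
    (φ : StrongDual ℝ X) : @Measurable X ℝ (weakBaire X) (borel ℝ) φ := by
  let f : C(WeakSpace ℝ X, ℝ) := ⟨fun x => φ ((toWeakSpace ℝ X).symm x),
    WeakBilin.eval_continuous (topDualPairing ℝ X).flip φ⟩
  rintro u hu
  refine ⟨f ⁻¹' u, ?_, rfl⟩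
  exact (le_iSup (fun f : C(WeakSpace ℝ X, ℝ) => (borel ℝ).comap f) f) _ ⟨u, hu, rfl⟩

open Classical in
/-- The sum of the coefficients `y r` over the `r ⊆ s` with nonzero infimum and set of types `U`. -/
def coeff (n : ℕ) (s : Finset (Pos (MeasureAlgebra μ)))
    (y : Finset (Pos (MeasureAlgebra μ)) → ℝ) (N : Pos (MeasureAlgebra μ) → Set ℕ)
    (U : Finset (Finset ℕ)) : ℝ :=
  ∑ r ∈ s.powerset, if r.image (type N n) = U ∧ r.inf Subtype.val ≠ ⊥ then y r else 0

theorem exists_measurable_coeff [IsProbabilityMeasure μ] (hN : IsIndependent N) (n : ℕ)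
    (U : Finset (Finset ℕ)) :
    ∃ E : C(StoneSpace (genAlg N), ℝ) → ℝ,
      @Measurable (SPrime N) ℝ ((weakBaire _).comap Subtype.val) (borel ℝ) (fun g => E g) ∧
      ∀ s y, E (∑ r ∈ s.powerset, y r • ind N r) = coeff n s y N U := by
  classical
  choose φ hφ using isRealized_one_sub_pow hN n U
  have hlim : ∀ s y, Tendsto (fun j => φ j (∑ r ∈ s.powerset, y r • ind N r)) atTop
      (𝓝 (coeff n s y N U)) := by
    intro s y
    simp only [map_sum, map_smul, hφ, smul_eq_mul]
    refine tendsto_finsetSum _ fun r _ => ?_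
    by_cases hr : r.image (type N n) = U
    · simp only [hr, if_true, true_and]
      have h := (tendsto_one_sub_pow r).const_mul (y r)
      convert h using 2
      by_cases h0 : r.inf Subtype.val = ⊥ <;> simp [h0]
    · simp [hr]
  -- Where the sequence diverges `limUnder` is arbitrary, but on `SPrime N` the limit exists.
  refine ⟨fun g => limUnder atTop fun j => φ j g, ?_, fun s y => (hlim s y).limUnder_eq⟩
  let _ : MeasurableSpace (SPrime N) :=
    (weakBaire C(StoneSpace (genAlg N), ℝ)).comap Subtype.val
  change Measurable _
  refine measurable_of_tendsto_metrizable (f := fun j (g : SPrime N) => φ j g.1) (fun j => ?_) ?_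
  · exact (measurable_functional (φ j)).comp (comap_measurable _)
  · refine tendsto_pi_nhds.2 fun g => ?_
    obtain ⟨s, y, -, hg⟩ := (mem_SPrime_iff N).1 g.2
    rw [hg]
    exact tendsto_nhds_limUnder ⟨_, hlim s y⟩

open Classical in
/-- The supremum norm, computed from the system `E` of coefficients. -/
def coeffNorm (n : ℕ) (E : Finset (Finset ℕ) → ℝ) : ℝ :=
  (Finset.range n).powerset.powerset.sup' (Finset.powerset_nonempty _)
    fun U => if E U = 0 then 0 else |∑ V ∈ U.powerset, E V|

theorem measurable_coeffNorm {Ω : Type*} [MeasurableSpace Ω] (n : ℕ)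
    {E : Finset (Finset ℕ) → Ω → ℝ} (hE : ∀ U, Measurable (E U)) :
    Measurable fun ω => coeffNorm n fun U => E U ω := by
  classical
  unfold coeffNorm
  have h : ∀ U ∈ (Finset.range n).powerset.powerset,
      Measurable fun ω => if E U ω = 0 then 0 else |∑ V ∈ U.powerset, E V ω| := fun U _ =>
    Measurable.ite (hE U (measurableSet_singleton 0)) measurable_const
      (Finset.measurable_sum _ fun V _ => hE V).abs
  convert Finset.measurable_sup' (Finset.powerset_nonempty _) h using 1
  ext ω
  rw [Finset.sup'_apply]

/-! ### The norm in terms of the coefficients -/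

section Evaluation

variable {n : ℕ} {s : Finset (Pos (MeasureAlgebra μ))} {y : Finset (Pos (MeasureAlgebra μ)) → ℝ}

open Classical in
theorem image_type_subset_iff (hs : Set.InjOn (type N n) s)
    {r t : Finset (Pos (MeasureAlgebra μ))} (hr : r ⊆ s) (ht : t ⊆ s) :
    r.image (type N n) ⊆ t.image (type N n) ↔ r ⊆ t := by
  refine ⟨fun h b hb => ?_, Finset.image_subset_image⟩
  obtain ⟨b', hb', he⟩ := Finset.mem_image.1 (h (Finset.mem_image_of_mem _ hb))
  exact hs (ht hb') (hr hb) he ▸ hb'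

open Classical in
theorem coeff_image (hs : Set.InjOn (type N n) s) {t : Finset (Pos (MeasureAlgebra μ))}
    (ht : t ⊆ s) (h0 : t.inf Subtype.val ≠ ⊥) : coeff n s y N (t.image (type N n)) = y t := by
  unfold coeff
  rw [Finset.sum_eq_single_of_mem t (Finset.mem_powerset.2 ht)]
  · simp [h0]
  · intro r hr hrt
    refine if_neg fun h => hrt ?_
    rw [Finset.mem_powerset] at hr
    exact ((image_type_subset_iff hs hr ht).1 h.1.le).antisymm
      ((image_type_subset_iff hs ht hr).1 h.1.ge)

open Classical in
theorem exists_of_coeff_ne_zero {U : Finset (Finset ℕ)} (h : coeff n s y N U ≠ 0) :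
    ∃ t ⊆ s, t.inf Subtype.val ≠ ⊥ ∧ U = t.image (type N n) := by
  obtain ⟨t, ht, h1⟩ := Finset.exists_ne_zero_of_sum_ne_zero h
  have h2 := (ite_ne_right_iff.1 h1).1
  exact ⟨t, Finset.mem_powerset.1 ht, h2.2, h2.1.symm⟩

open Classical in
-- Subsets of `t` inherit a nonzero meet, so none of their coefficients is lost; injectivity of
-- types keeps out every `r` not contained in `t`.
theorem sum_coeff (hs : Set.InjOn (type N n) s) {t : Finset (Pos (MeasureAlgebra μ))}
    (ht : t ⊆ s) (h0 : t.inf Subtype.val ≠ ⊥) :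
    ∑ V ∈ (t.image (type N n)).powerset, coeff n s y N V = ∑ r ∈ t.powerset, y r := by
  unfold coeff
  rw [Finset.sum_comm]
  have hsub : t.powerset ⊆ s.powerset := Finset.powerset_mono.2 ht
  rw [← Finset.sum_subset hsub (f := fun r => ∑ V ∈ (t.image (type N n)).powerset,
    if r.image (type N n) = V ∧ r.inf Subtype.val ≠ ⊥ then y r else 0)]
  · refine Finset.sum_congr rfl fun r hr => ?_
    rw [Finset.mem_powerset] at hr
    have hr0 : r.inf Subtype.val ≠ ⊥ := fun h =>
      h0 (le_bot_iff.1 ((Finset.inf_mono hr).trans h.le))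
    simp [hr0, Finset.image_subset_image hr]
  · intro r hr hrt
    rw [Finset.mem_powerset] at hr hrt
    refine Finset.sum_eq_zero fun V hV => if_neg fun h => hrt ?_
    rw [Finset.mem_powerset, ← h.1] at hV
    exact (image_type_subset_iff hs hr ht).1 hV

theorem sum_smul_ind_apply (F : StoneSpace (genAlg N)) {t : Finset (Pos (MeasureAlgebra μ))}
    (ht : t ⊆ s) (hF : ∀ b ∈ s, (G N b ∈ F.carrier ↔ b ∈ t)) :
    (∑ r ∈ s.powerset, y r • ind N r) F = ∑ r ∈ t.powerset, y r := by
  classical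
  rw [ContinuousMap.sum_apply, ← Finset.sum_subset (Finset.powerset_mono.2 ht)]
  · refine Finset.sum_congr rfl fun r hr => ?_
    rw [Finset.mem_powerset] at hr
    rw [ContinuousMap.smul_apply, ind_apply,
      if_pos fun b hb => (hF b (ht (hr hb))).2 (hr hb), smul_eq_mul, mul_one]
  · intro r hr hrt
    rw [Finset.mem_powerset] at hr hrt
    have : ¬ ∀ b ∈ r, G N b ∈ F.carrier := fun h => hrt fun b hb => (hF b (hr hb)).1 (h b hb)
    rw [ContinuousMap.smul_apply, ind_apply, if_neg this, smul_zero]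

/-- Since all `y r` are nonzero, `coeff n s y N U ≠ 0` holds exactly when `U` is the type set of a
`t ⊆ s` with nonzero meet, that is, of the trace of a point. The maximum in `coeffNorm` thus runs
over the absolute values attained by the function. -/
theorem norm_sum_smul_ind (hN : IsIndependent N) (hs : Set.InjOn (type N n) s)
    (hy : ∀ r ∈ s.powerset, y r ≠ 0) :
    ‖∑ r ∈ s.powerset, y r • ind N r‖ = coeffNorm n (coeff n s y N) := by
  classical
  have hnonneg : 0 ≤ coeffNorm n (coeff n s y N) := by
    refine Finset.le_sup'_of_le _ (b := ∅) (by simp) ?_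
    split_ifs
    exacts [le_rfl, abs_nonneg _]
  refine le_antisymm ((ContinuousMap.norm_le _ hnonneg).2 fun F => ?_)
    (Finset.sup'_le _ _ fun U _ => ?_)
  · set t := s.filter fun b => G N b ∈ F.carrier with ht_def
    have ht : t ⊆ s := Finset.filter_subset _ _
    have h0 : t.inf Subtype.val ≠ ⊥ := inf_ne_bot_of_J_mem N F
      ((J_mem_iff N F t).2 fun b hb => (Finset.mem_filter.1 hb).2)
    rw [sum_smul_ind_apply F ht fun b hb => by simp [ht_def, hb], Real.norm_eq_abs]
    refine Finset.le_sup'_of_le _ (b := t.image (type N n)) ?_ ?_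
    · rw [Finset.mem_powerset, Finset.image_subset_iff]
      exact fun b _ => Finset.mem_powerset.2 (Finset.filter_subset _ _)
    · rw [coeff_image hs ht h0, if_neg (hy t (Finset.mem_powerset.2 ht)), sum_coeff hs ht h0]
  · split_ifs with hU
    · positivity
    · obtain ⟨t, ht, h0, rfl⟩ := exists_of_coeff_ne_zero hU
      obtain ⟨F, hF⟩ := exists_point (s := s) hN h0
      rw [sum_coeff hs ht h0, ← sum_smul_ind_apply F ht hF, ← Real.norm_eq_abs]
      exact ContinuousMap.norm_coe_le_norm _ F

end Evaluation

/-- The level `n` from which types separate `s` varies with the function, so the norm is a pointwise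
limit of the `coeffNorm n`, eventually constant at each function. -/
theorem measurable_norm_SPrime [IsProbabilityMeasure μ] (hN : IsIndependent N) :
    @Measurable (SPrime N) ℝ ((weakBaire C(StoneSpace (genAlg N), ℝ)).comap Subtype.val)
      (borel ℝ) (fun g => ‖g.1‖) := by
  choose E hE hEc using fun n => exists_measurable_coeff hN n
  let _ : MeasurableSpace (SPrime N) :=
    (weakBaire C(StoneSpace (genAlg N), ℝ)).comap Subtype.val
  change Measurable _
  refine measurable_of_tendsto_metrizable
    (f := fun n (g : SPrime N) => coeffNorm n fun U => E n U g.1)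
    (fun n => measurable_coeffNorm n (hE n)) (tendsto_pi_nhds.2 fun g => ?_)
  obtain ⟨s, y, hy, hg⟩ := (mem_SPrime_iff N).1 g.2
  refine tendsto_const_nhds.congr' ((eventually_type_injOn hN s).mono fun n hn => ?_)
  rw [hg]
  simp only [hEc]
  exact norm_sum_smul_ind hN hn hy

end TraceNorm

instance (I : Type*) : IsProbabilityMeasure (cubeMeasure I) := by
  unfold cubeMeasure
  infer_instance

end WeakBaire

end

theorem theorem3 (I : Type*) (hI₁ : Cardinal.aleph 1 ≤ Cardinal.mk I)
    (hI₂ : Cardinal.mk I ≤ Cardinal.continuum)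
    (N : WeakBaire.Pos (WeakBaire.MeasureAlgebra (WeakBaire.cubeMeasure I)) → Set ℕ)
    (hN : WeakBaire.IsIndependent N) :
    Dense (WeakBaire.SPrime N) ∧
    @Measurable (WeakBaire.SPrime N) ℝ
      ((WeakBaire.weakBaire C(WeakBaire.StoneSpace (WeakBaire.genAlg N), ℝ)).comap Subtype.val)
      (borel ℝ) (fun g => ‖g.1‖) :=
  ⟨WeakBaire.dense_SPrime N, WeakBaire.measurable_norm_SPrime hN⟩
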